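/- Let $n\ge 2$ be an integer and let $f\in L^1(\mathbb{R})$ be a nonnegative function with $t^{2n-2}f(t)\in L^1(\mathbb{R})$. Let $$\mathcal{F}f(x)=\int_{\mathbb{R}}e^{-ixt}f(t)\,dt,\qquad x\in\mathbb{R},$$ be its Fourier transform, which is $2n-2$ times continuously differentiable, let $$W_n(\mathcal{F}f;x)=\det\bigl[(\mathcal{F}f)^{(i+j)}(x)\bigr]_{i,j=0}^{n-1}$$ be the $n$-th Wronskian determinant of $\mathcal{F}f$, and let $$\nu_n(f;t)=\int_{\mathbb{R}^{n-1}}\ \prod_{1\le i<j\le n}(s_i-s_j)^2\ \prod_{i=1}^{n}f(s_i)\ ds_1\cdots ds_{n-1},\qquad s_n:=t-s_1-\cdots-s_{n-1},$$ be the correlation function of $f$, which belongs to $L^1(\mathbb{R})$. Then, whether $L^1(\mathbb{R})$ and $L^2(\mathbb{R})$ are taken as spaces of real-valued functions with real scalars or of complex-valued functions with complex scalars: 1. $W_n(\mathcal{F}f;x)\neq 0$ for all $x\in\mathbb{R}$ if and only if the linear span of the translates $x\mapsto \nu_n(f;x+a)$, $a\in\mathbb{R}$, is dense in $L^1(\mathbb{R})$.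 2. If $\nu_n(f)\in L^2(\mathbb{R})$, then the set $\{x\in\mathbb{R}: W_n(\mathcal{F}f;x)=0\}$ has Lebesgue measure zero if and only if the linear span of the translates $x\mapsto \nu_n(f;x+a)$, $a\in\mathbb{R}$, is dense in $L^2(\mathbb{R})$. -/

import Mathlib

open MeasureTheory

noncomputable section

/-- The Fourier transform `x ↦ ∫ e^{-i x t} f(t) dt` of a real function `f`
(without a factor `2π` in the exponent). -/
def fourierTransform (f : ℝ → ℝ) (x : ℝ) : ℂ :=
  ∫ t : ℝ, Complex.exp (-(Complex.I * (x : ℂ) * (t : ℂ))) * (f t : ℂ)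

/-- The `n`-th Wronskian determinant `det [F^{(i+j)}(x)]_{i,j = 0}^{n-1}`. -/
def wronskianDet (n : ℕ) (F : ℝ → ℂ) (x : ℝ) : ℂ :=
  Matrix.det (Matrix.of fun i j : Fin n => iteratedDeriv ((i : ℕ) + (j : ℕ)) F x)

/-- The point `(s_1, …, s_m, t - s_1 - ⋯ - s_m)` of the hyperplane
`{p ∈ ℝ^{m+1} : p_1 + ⋯ + p_{m+1} = t}`. -/
def hyperplanePoint {m : ℕ} (t : ℝ) (s : Fin m → ℝ) : Fin (m + 1) → ℝ :=
  Fin.snoc (α := fun _ => ℝ) s (t - ∑ i, s i)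

/-- The correlation function `ν_n(w; t)`: the integral of
`∏_{i < j} (p_i - p_j)^2 · w(p_1) ⋯ w(p_n)` over the hyperplane `p_1 + ⋯ + p_n = t`, with respect
to Lebesgue measure `dp_1 ⋯ dp_{n-1}` in the first `n - 1` coordinates.
(The value at `n = 0` is a convention; at `n = 1` the formula gives `ν_1(w; t) = w(t)`.) -/
def correlationFun : ℕ → (ℝ → ℝ) → ℝ → ℝ
  | 0, _, _ => 0
  | m + 1, w, t => ∫ s : Fin m → ℝ,
      (∏ i, ∏ j ∈ Finset.Ioi i, (hyperplanePoint t s i - hyperplanePoint t s j) ^ 2) *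
        ∏ i, w (hyperplanePoint t s i)

/-- The linear span in `L^p(ℝ)`, with scalars and values in `𝕜` (that is, `ℝ` or `ℂ`), of the
translates `x ↦ g (x + a)`, `a ∈ ℝ`, of a real function `g`. -/
def translateSpan (𝕜 : Type*) [RCLike 𝕜] (p : ENNReal) (g : ℝ → ℝ) :
    Submodule 𝕜 (Lp 𝕜 p (volume : Measure ℝ)) :=
  Submodule.span 𝕜 {h | ∃ a : ℝ, h =ᵐ[volume] fun x : ℝ => ((g (x + a) : ℝ) : 𝕜)}

end

/-! On the hyperplane `p_1 + ⋯ + p_n = t` the character `e^{-ixt}` is the product of the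
`e^{-ixp_i}`. Fubini over these hyperplanes therefore turns the Fourier transform of the correlation
function into an integral over `ℝ^n` of the squared Vandermonde product against the weight `e^{-ixt}
f(t)` in each variable. Heine's formula (`integral_prod_sub_sq_mul_prod`) evaluates it as `n!` times
the Hankel determinant of the moments. These moments are, up to powers of `-i`, the derivatives of
`ℱf`, so the transform of `ν_n` and the Wronskian have the same zeros
(`wronskianDet_fourierTransform_eq_zero_iff`).

Both claims thus reduce to Wiener's theorems: translates of `g` span a dense subspace of `L¹` iff
`ĝ` has no zero (`dense_translateSpan_one_iff`), and of `L²` iff `ĝ` is nonzero almost everywhere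
(`dense_translateSpan_two_iff`). The first rests on a local division argument modulo a closed
translation-invariant subspace, the second on Plancherel. Both are proved over `ℂ` and transferred
to `𝕜`. -/

open scoped FourierTransform SchwartzMap ContDiff Topology

/-! ### Translations, Fourier uniqueness and convolution on `L¹`. -/

/-- Translation `h ↦ h (· + a)` on `L^p(ℝ; ℂ)`. -/
noncomputable def lpTranslate (p : ENNReal) [Fact (1 ≤ p)] (a : ℝ) :
    Lp ℂ p (volume : Measure ℝ) →ₗᵢ[ℂ] Lp ℂ p (volume : Measure ℝ) :=
  Lp.compMeasurePreservingₗᵢ ℂ (fun x => x + a) (measurePreserving_add_right volume a)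

lemma coeFn_lpTranslate (p : ENNReal) [Fact (1 ≤ p)] (a : ℝ) (h : Lp ℂ p (volume : Measure ℝ)) :
    lpTranslate p a h =ᵐ[volume] fun x => h (x + a) :=
  Lp.coeFn_compMeasurePreserving h (measurePreserving_add_right volume a)

lemma lpTranslate_zero (p : ENNReal) [Fact (1 ≤ p)] (h : Lp ℂ p (volume : Measure ℝ)) :
    lpTranslate p 0 h = h := by
  apply Lp.ext
  filter_upwards [coeFn_lpTranslate p 0 h] with x h1
  rw [h1, add_zero]

lemma continuous_lpTranslate (p : ENNReal) [Fact (1 ≤ p)] (hp : p ≠ ⊤)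
    (h : Lp ℂ p (volume : Measure ℝ)) : Continuous fun a => lpTranslate p a h := by
  let F : C(ℝ × ℝ, ℝ) := ⟨fun q => q.2 + q.1, by fun_prop⟩
  exact Continuous.compMeasurePreservingLp (f := fun _ : ℝ => h) (g := fun a => F.curry a)
    continuous_const F.curry.continuous (fun a => measurePreserving_add_right volume a) hp

/-- Evaluation at `x` of the Fourier transform of an integrable function. -/
noncomputable def fourierAt (x : ℝ) : Lp ℂ 1 (volume : Measure ℝ) →L[ℂ] ℂ :=
  (BoundedContinuousFunction.evalCLM ℂ x).comp (Real.Lp.fourierTransformCLM ℝ ℂ)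

lemma fourierAt_apply (x : ℝ) (h : Lp ℂ 1 (volume : Measure ℝ)) :
    fourierAt x h = 𝓕 (h : ℝ → ℂ) x := rfl

lemma fourierAt_toL1 (x : ℝ) {h : ℝ → ℂ} (hh : MemLp h 1) :
    fourierAt x hh.toLp = 𝓕 h x :=
  Real.fourier_congr_ae hh.coeFn_toLp x

lemma fourier_comp_add (h : ℝ → ℂ) (a x : ℝ) :
    𝓕 (fun t => h (t + a)) x = 𝐞 (a * x) * 𝓕 h x := by
  have := congrFun (VectorFourier.fourierIntegral_comp_add_right Real.fourierChar volume
    (innerₗ ℝ) h a) x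
  simp only [Circle.smul_def, smul_eq_mul, innerₗ_apply_apply, RCLike.inner_apply,
    conj_trivial, mul_comm x a] at this
  exact this

lemma fourierAt_lpTranslate (x a : ℝ) (h : Lp ℂ 1 (volume : Measure ℝ)) :
    fourierAt x (lpTranslate 1 a h) = 𝐞 (a * x) * fourierAt x h := by
  rw [fourierAt_apply, Real.fourier_congr_ae (coeFn_lpTranslate 1 a h), fourier_comp_add]
  rfl

lemma integral_fourier_mul_eq_flip {f g : ℝ → ℂ} (hf : Integrable f) (hg : Integrable g) :
    ∫ x, 𝓕 f x * g x = ∫ x, f x * 𝓕 g x := by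
  have := VectorFourier.integral_fourierIntegral_smul_eq_flip (L := innerₗ ℝ) (μ := volume)
    (ν := volume) Real.continuous_fourierChar (by fun_prop) hf hg
  simp only [smul_eq_mul] at this
  rw [flip_innerₗ] at this
  exact this

lemma ae_eq_zero_of_forall_schwartz {h : ℝ → ℂ} (hh : LocallyIntegrable h)
    (H : ∀ φ : 𝓢(ℝ, ℂ), ∫ x, h x * φ x = 0) : h =ᵐ[volume] 0 := by
  apply ae_eq_zero_of_integral_contDiff_smul_eq_zero hh
  intro g g_smooth g_cpt
  have hg₁ : HasCompactSupport (Complex.ofRealCLM ∘ g) := g_cpt.comp_left rfl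
  have hg₂ : ContDiff ℝ ∞ (Complex.ofRealCLM ∘ g) := by fun_prop
  rw [← H (hg₁.toSchwartzMap hg₂)]
  congr with x
  simp [mul_comm]

/-- Every Schwartz `φ` is itself a Fourier transform, so the transform can be moved from `𝓕⁻ φ` onto
`h`. -/
lemma ae_eq_zero_of_fourier_eq_zero {h : ℝ → ℂ} (hh : Integrable h)
    (H : ∀ x, 𝓕 h x = 0) : h =ᵐ[volume] 0 := by
  apply ae_eq_zero_of_forall_schwartz hh.locallyIntegrable
  intro φ
  have h1 := integral_fourier_mul_eq_flip hh (𝓕⁻ φ).integrable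
  rw [← SchwartzMap.fourier_coe, FourierTransform.fourier_fourierInv_eq] at h1
  rw [← h1]
  simp [H]

lemma L1_ext_fourierAt {h k : Lp ℂ 1 (volume : Measure ℝ)}
    (H : ∀ x, fourierAt x h = fourierAt x k) : h = k := by
  rw [← sub_eq_zero, Lp.eq_zero_iff_ae_eq_zero]
  apply ae_eq_zero_of_fourier_eq_zero (L1.integrable_coeFn _)
  intro x
  rw [← fourierAt_apply, map_sub, H, sub_self]

/-- Convolution on `L¹(ℝ)`, as a Bochner integral of translates. -/
noncomputable def l1Conv (w h : Lp ℂ 1 (volume : Measure ℝ)) : Lp ℂ 1 (volume : Measure ℝ) :=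
  ∫ y, w y • lpTranslate 1 (-y) h

lemma integrable_smul_lpTranslate (w h : Lp ℂ 1 (volume : Measure ℝ)) :
    Integrable fun y => w y • lpTranslate 1 (-y) h := by
  refine (L1.integrable_coeFn w).smul_bdd (C := ‖h‖) ?_ ?_
  · exact ((continuous_lpTranslate 1 ENNReal.one_ne_top h).comp
      continuous_neg).aestronglyMeasurable
  · exact .of_forall fun y => by simp

lemma fourierAt_l1Conv (x : ℝ) (w h : Lp ℂ 1 (volume : Measure ℝ)) :
    fourierAt x (l1Conv w h) = fourierAt x w * fourierAt x h := by
  rw [l1Conv, ← ContinuousLinearMap.integral_comp_comm _ (integrable_smul_lpTranslate w h),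
    fourierAt_apply x w, Real.fourier_real_eq, ← integral_mul_const]
  congr with y
  simp [fourierAt_lpTranslate, Circle.smul_def]
  ring

/-! ### Closed translation-invariant subspaces and their quotients. -/

/-- A closed subspace of `L¹(ℝ)` that is stable under translations. -/
structure IsClosedTranslationInvariant (I : Submodule ℂ (Lp ℂ 1 (volume : Measure ℝ))) : Prop where
  isClosed : IsClosed (I : Set (Lp ℂ 1 (volume : Measure ℝ)))
  translate_mem : ∀ a : ℝ, ∀ h ∈ I, lpTranslate 1 a h ∈ I

variable {I : Submodule ℂ (Lp ℂ 1 (volume : Measure ℝ))}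

/-- The quotient map modulo `I` is continuous, hence passes under the Bochner integral, and it kills
every translate of `h`. -/
lemma IsClosedTranslationInvariant.l1Conv_mem (hI : IsClosedTranslationInvariant I)
    (w : Lp ℂ 1 (volume : Measure ℝ)) {h : Lp ℂ 1 (volume : Measure ℝ)} (hh : h ∈ I) :
    l1Conv w h ∈ I := by
  have := hI.isClosed
  rw [← Submodule.ker_mkQ I, LinearMap.mem_ker]
  change I.mkQL _ = 0
  rw [l1Conv, ← ContinuousLinearMap.integral_comp_comm _ (integrable_smul_lpTranslate w h)]
  apply integral_eq_zero_of_ae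
  refine .of_forall fun y => ?_
  exact (Submodule.Quotient.mk_eq_zero I).2 (I.smul_mem _ (hI.translate_mem _ _ hh))

lemma IsClosedTranslationInvariant.norm_mk_lpTranslate_le (hI : IsClosedTranslationInvariant I) (a : ℝ)
    (h : Lp ℂ 1 (volume : Measure ℝ)) : ‖I.mkQ (lpTranslate 1 a h)‖ ≤ ‖I.mkQ h‖ := by
  apply le_of_forall_pos_le_add
  intro ε hε
  obtain ⟨m, hm, hm'⟩ := Submodule.Quotient.norm_mk_lt (I.mkQ h) hε
  have h1 : I.mkQ (lpTranslate 1 a h) = I.mkQ (lpTranslate 1 a m) := by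
    have h2 : h - m ∈ I := (Submodule.Quotient.eq I).1 hm.symm
    refine (Submodule.Quotient.eq I).2 ?_
    rw [← map_sub]
    exact hI.translate_mem a _ h2
  rw [h1]
  refine (Submodule.Quotient.norm_mk_le I _).trans ?_
  rw [LinearIsometry.norm_map]
  exact hm'.le

/-- Translations contract the quotient norm. Having that norm on the right too is what allows the
absorption argument below. -/
lemma IsClosedTranslationInvariant.norm_mk_l1Conv_le (hI : IsClosedTranslationInvariant I)
    (w h : Lp ℂ 1 (volume : Measure ℝ)) : ‖I.mkQ (l1Conv w h)‖ ≤ ‖w‖ * ‖I.mkQ h‖ := by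
  have := hI.isClosed
  change ‖I.mkQL _‖ ≤ _
  rw [l1Conv, ← ContinuousLinearMap.integral_comp_comm _ (integrable_smul_lpTranslate w h),
    L1.norm_eq_integral_norm, ← integral_mul_const]
  apply norm_integral_le_of_norm_le ((L1.integrable_coeFn w).norm.mul_const _)
  refine .of_forall fun y => ?_
  rw [map_smul, norm_smul]
  gcongr
  exact hI.norm_mk_lpTranslate_le _ _

/-! ### Approximation by modulated dilations of a kernel. -/

lemma tendsto_integral_norm_sub_lpTranslate (u : Lp ℂ 1 (volume : Measure ℝ))
    (v : Lp ℂ 1 (volume : Measure ℝ)) :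
    Filter.Tendsto (fun δ : ℝ => ∫ y, ‖u y‖ * ‖v - lpTranslate 1 (-(δ * y)) v‖) (𝓝 0) (𝓝 0) := by
  have hc : ∀ δ : ℝ, Continuous fun y : ℝ => ‖v - lpTranslate 1 (-(δ * y)) v‖ := fun δ =>
    (continuous_const.sub ((continuous_lpTranslate 1 ENNReal.one_ne_top v).comp
      (by fun_prop : Continuous fun y : ℝ => -(δ * y)))).norm
  have h0 : ∫ y, ‖u y‖ * ‖v - lpTranslate 1 (-(0 * y)) v‖ = 0 := by
    simp [lpTranslate_zero]
  conv => enter [3, 1]; rw [← h0]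
  refine tendsto_integral_filter_of_dominated_convergence (fun y => ‖u y‖ * (‖v‖ + ‖v‖)) ?_ ?_ ?_ ?_
  · exact .of_forall fun δ =>
      (Lp.aestronglyMeasurable u).norm.mul (hc δ).aestronglyMeasurable
  · refine .of_forall fun δ => .of_forall fun y => ?_
    rw [Real.norm_of_nonneg (by positivity)]
    gcongr
    refine (norm_sub_le _ _).trans ?_
    rw [LinearIsometry.norm_map]
  · exact (L1.integrable_coeFn u).norm.mul_const _
  · refine .of_forall fun y => ?_
    have : Continuous fun δ : ℝ => ‖u y‖ * ‖v - lpTranslate 1 (-(δ * y)) v‖ :=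
      continuous_const.mul (continuous_const.sub
        ((continuous_lpTranslate 1 ENNReal.one_ne_top v).comp
          (by fun_prop : Continuous fun δ : ℝ => -(δ * y)))).norm
    exact this.tendsto 0

/-- The modulated dilation `t ↦ e^{2πi x₀ t} δ V(δ t)`. -/
noncomputable def modDilate (x₀ δ : ℝ) (V : ℝ → ℂ) (t : ℝ) : ℂ :=
  𝐞 (x₀ * t) * (δ * V (δ * t))

lemma integrable_modDilate (x₀ : ℝ) {δ : ℝ} (hδ : 0 < δ) {V : ℝ → ℂ} (hV : Integrable V) :
    Integrable (modDilate x₀ δ V) := by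
  refine ((hV.comp_mul_left' hδ.ne').const_mul (δ : ℂ)).bdd_mul (c := 1) ?_ ?_
  · exact (by fun_prop : Continuous fun t : ℝ => ((𝐞 (x₀ * t) : Circle) : ℂ)).aestronglyMeasurable
  · exact .of_forall fun y => (Circle.norm_coe _).le

lemma fourier_modDilate (x₀ : ℝ) {δ : ℝ} (hδ : 0 < δ) (V : ℝ → ℂ) (x : ℝ) :
    𝓕 (modDilate x₀ δ V) x = 𝓕 V ((x - x₀) / δ) := by
  rw [Real.fourier_real_eq, Real.fourier_real_eq]
  have h := Measure.integral_comp_mul_left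
    (fun t : ℝ => 𝐞 (-(t * ((x - x₀) / δ))) • V t) δ
  rw [abs_of_pos (inv_pos.2 hδ), eq_inv_smul_iff₀ hδ.ne', ← integral_smul] at h
  rw [← h]
  congr with t
  have : -(δ * t * ((x - x₀) / δ)) = -(t * x) + x₀ * t := by field_simp; ring
  rw [this, AddChar.map_add_eq_mul]
  simp [modDilate, Circle.smul_def]
  ring

/-- The phase `𝐞 (-(y * x₀))` matches the modulations of the two terms; substituting `δ t` then
leaves a shift of `V` by only `δ y`, which is small for small `δ`. -/
lemma norm_smul_modDilate_sub (x₀ : ℝ) {δ : ℝ} (hδ : 0 < δ) {V : ℝ → ℂ} (hV : MemLp V 1 volume)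
    (hK : MemLp (modDilate x₀ δ V) 1 volume) (y : ℝ) :
    ‖((𝐞 (-(y * x₀)) : Circle) : ℂ) • hK.toLp - lpTranslate 1 (-y) hK.toLp‖ =
      ‖hV.toLp - lpTranslate 1 (-(δ * y)) hV.toLp‖ := by
  rw [L1.norm_eq_integral_norm, L1.norm_eq_integral_norm]
  have h := Measure.integral_comp_mul_left (fun t : ℝ => ‖V t - V (t + -(δ * y))‖) δ
  rw [abs_of_pos (inv_pos.2 hδ), eq_inv_smul_iff₀ hδ.ne', ← integral_smul] at h
  have hV' := hV.coeFn_toLp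
  have hK' := hK.coeFn_toLp
  have h1 : ∫ a, ‖(hV.toLp - lpTranslate 1 (-(δ * y)) hV.toLp : Lp ℂ 1 volume) a‖ =
      ∫ t, ‖V t - V (t + -(δ * y))‖ := by
    apply integral_congr_ae
    filter_upwards [Lp.coeFn_sub hV.toLp (lpTranslate 1 (-(δ * y)) hV.toLp), hV',
      coeFn_lpTranslate 1 (-(δ * y)) hV.toLp,
      (measurePreserving_add_right volume (-(δ * y))).quasiMeasurePreserving.ae hV'] with t h1 h2 h3 h4
    rw [h1, Pi.sub_apply, h2, h3, h4]
  rw [h1, ← h]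
  apply integral_congr_ae
  filter_upwards [Lp.coeFn_sub (((𝐞 (-(y * x₀)) : Circle) : ℂ) • hK.toLp)
      (lpTranslate 1 (-y) hK.toLp), hK',
    Lp.coeFn_smul ((𝐞 (-(y * x₀)) : Circle) : ℂ) hK.toLp,
    coeFn_lpTranslate 1 (-y) hK.toLp,
    (measurePreserving_add_right volume (-y)).quasiMeasurePreserving.ae hK'] with t h1 h2 h3 h4 h5
  rw [h1, Pi.sub_apply, h3, Pi.smul_apply, h2, h4, h5, modDilate, modDilate]
  have e1 : x₀ * (t + -y) = -(y * x₀) + x₀ * t := by ring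
  have e2 : δ * (t + -y) = δ * t + -(δ * y) := by ring
  rw [e1, e2, AddChar.map_add_eq_mul, Circle.coe_mul, smul_eq_mul]
  have e3 : ((𝐞 (-(y * x₀)) : Circle) : ℂ) * (((𝐞 (x₀ * t) : Circle) : ℂ) * (δ * V (δ * t))) -
      ((𝐞 (-(y * x₀)) : Circle) : ℂ) * ((𝐞 (x₀ * t) : Circle) : ℂ) *
        (δ * V (δ * t + -(δ * y))) =
      ((𝐞 (-(y * x₀)) : Circle) : ℂ) * ((𝐞 (x₀ * t) : Circle) : ℂ) *
        (δ * (V (δ * t) - V (δ * t + -(δ * y)))) := by ring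
  rw [e3]
  simp only [norm_mul, Circle.norm_coe, Complex.norm_real, Real.norm_of_nonneg hδ.le, one_mul,
    smul_eq_mul]

/-- A kernel `K` concentrated at frequency `x₀` sees `g` only through `ĝ(x₀)`: the difference is the
integral of `g(y)` times `e^{-2πi y x₀} K - K(· - y)`. -/
lemma exists_norm_smul_sub_l1Conv_modDilate_lt (g : Lp ℂ 1 (volume : Measure ℝ)) (x₀ : ℝ) {V : ℝ → ℂ}
    (hV : MemLp V 1 volume) {ε : ℝ} (hε : 0 < ε) :
    ∃ δ : ℝ, 0 < δ ∧ ∃ hK : MemLp (modDilate x₀ δ V) 1,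
      ‖fourierAt x₀ g • hK.toLp - l1Conv g hK.toLp‖ < ε := by
  have h := (tendsto_integral_norm_sub_lpTranslate g hV.toLp).mono_left
    (nhdsWithin_le_nhds (s := Set.Ioi 0))
  obtain ⟨δ, hδε, hδ⟩ := ((h.eventually_lt_const hε).and self_mem_nhdsWithin).exists
  have hK : MemLp (modDilate x₀ δ V) 1 :=
    memLp_one_iff_integrable.2 (integrable_modDilate x₀ hδ (memLp_one_iff_integrable.1 hV))
  refine ⟨δ, hδ, hK, lt_of_le_of_lt ?_ hδε⟩
  have hi : Integrable fun y => (𝐞 (-(y * x₀)) • g y) := by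
    have := (Real.fourierIntegral_convergent_iff (μ := volume) x₀).2 (L1.integrable_coeFn g)
    simpa only [RCLike.inner_apply, conj_trivial, mul_comm x₀] using this
  rw [fourierAt_apply, Real.fourier_real_eq, ← integral_smul_const, l1Conv,
    ← integral_sub (hi.smul_const _) (integrable_smul_lpTranslate g _)]
  refine (norm_integral_le_integral_norm _).trans_eq ?_
  congr with y
  rw [← norm_smul_modDilate_sub x₀ hδ hV hK y, ← norm_smul, smul_sub, Circle.smul_def,
    smul_smul, smul_eq_mul, mul_comm]

lemma exists_norm_sub_l1Conv_modDilate_lt (h : Lp ℂ 1 (volume : Measure ℝ)) {V : ℝ → ℂ}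
    (hV : MemLp V 1 volume) (hV1 : 𝓕 V 0 = 1) {ε : ℝ} (hε : 0 < ε) :
    ∃ R : ℝ, 0 < R ∧ ∃ hK : MemLp (modDilate 0 R V) 1, ‖h - l1Conv hK.toLp h‖ < ε := by
  have H := (tendsto_integral_norm_sub_lpTranslate hV.toLp h).mono_left
    (nhdsWithin_le_nhds (s := Set.Ioi 0))
  obtain ⟨δ, hδε, hδ⟩ := ((H.eventually_lt_const hε).and self_mem_nhdsWithin).exists
  replace hδ : 0 < δ := hδ
  have hR : 0 < δ⁻¹ := inv_pos.2 hδ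
  have hK : MemLp (modDilate 0 δ⁻¹ V) 1 :=
    memLp_one_iff_integrable.2 (integrable_modDilate 0 hR (memLp_one_iff_integrable.1 hV))
  refine ⟨δ⁻¹, hR, hK, lt_of_le_of_lt ?_ hδε⟩
  -- The kernel has total mass `𝓕 V 0 = 1`, as for any approximate identity.
  have h1 : h = ∫ y, (hK.toLp : Lp ℂ 1 volume) y • h := by
    rw [integral_smul_const]
    have : ∫ y, (hK.toLp : Lp ℂ 1 volume) y = 1 := by
      have := fourier_modDilate 0 hR V 0
      rw [sub_self, zero_div, hV1, ← fourierAt_toL1 0 hK, fourierAt_apply,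
        Real.fourier_real_eq] at this
      simpa using this
    rw [this, one_smul]
  conv_lhs => enter [1, 1]; rw [h1]
  rw [l1Conv, ← integral_sub ((L1.integrable_coeFn _).smul_const _)
    (integrable_smul_lpTranslate _ h)]
  refine (norm_integral_le_integral_norm _).trans_eq ?_
  have h2 := Measure.integral_comp_mul_left
    (fun t : ℝ => ‖V t‖ * ‖h - lpTranslate 1 (-(δ * t)) h‖) δ⁻¹
  rw [abs_of_pos (inv_pos.2 hR), eq_inv_smul_iff₀ hR.ne', ← integral_smul] at h2
  have h3 : ∫ y, ‖(hV.toLp : Lp ℂ 1 volume) y‖ * ‖h - lpTranslate 1 (-(δ * y)) h‖ =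
      ∫ t : ℝ, ‖V t‖ * ‖h - lpTranslate 1 (-(δ * t)) h‖ := by
    apply integral_congr_ae
    filter_upwards [hV.coeFn_toLp] with t ht
    rw [ht]
  rw [h3, ← h2]
  apply integral_congr_ae
  filter_upwards [hK.coeFn_toLp] with t ht
  rw [ht, ← smul_sub, norm_smul, modDilate, mul_inv_cancel_left₀ hδ.ne']
  simp [abs_of_pos hδ]
  ring

lemma exists_fourierAt_eq {ρ : ℝ → ℝ} (hc : HasCompactSupport ρ) (hs : ContDiff ℝ ∞ ρ) :
    ∃ k : Lp ℂ 1 (volume : Measure ℝ), ∀ x, fourierAt x k = ρ x := by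
  have hg₁ : HasCompactSupport (Complex.ofRealCLM ∘ ρ) := hc.comp_left rfl
  have hg₂ : ContDiff ℝ ∞ (Complex.ofRealCLM ∘ ρ) := by fun_prop
  refine ⟨(memLp_one_iff_integrable.2 (𝓕⁻ (hg₁.toSchwartzMap hg₂)).integrable).toLp, fun x => ?_⟩
  rw [fourierAt_toL1, ← SchwartzMap.fourier_coe, FourierTransform.fourier_fourierInv_eq]
  rfl

lemma exists_fourier_cutoff : ∃ V : ℝ → ℂ, MemLp V 1 volume ∧
    (∀ x, |x| ≤ 1 → 𝓕 V x = 1) ∧ ∀ x, 2 ≤ |x| → 𝓕 V x = 0 := by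
  let ρ : ContDiffBump (0 : ℝ) := ⟨1, 2, one_pos, one_lt_two⟩
  obtain ⟨k, hk⟩ := exists_fourierAt_eq ρ.hasCompactSupport ρ.contDiff
  refine ⟨k, Lp.memLp k, fun x hx => ?_, fun x hx => ?_⟩
  · rw [← fourierAt_apply, hk, ρ.one_of_mem_closedBall (by simpa using hx), Complex.ofReal_one]
  · rw [← fourierAt_apply, hk, ρ.zero_of_le_dist (by simpa using hx), Complex.ofReal_zero]

/-! ### Wiener's theorem in `L¹`. -/

/-- Local division by `ĝ`. If `k̂` lives where `K̂ = 1`, then `ĝ(x₀) k = k * g + w * k` with `w =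
ĝ(x₀) K - g * K` and `‖w‖ < |ĝ(x₀)|`. Since `k * g ∈ I`, the class of `k` modulo `I` satisfies
`|ĝ(x₀)| ‖k‖ ≤ ‖w‖ ‖k‖`, so it is zero. -/
lemma IsClosedTranslationInvariant.exists_forall_mem_of_fourierAt_ne_zero
    (hI : IsClosedTranslationInvariant I) {g : Lp ℂ 1 (volume : Measure ℝ)} (hg : g ∈ I) {x₀ : ℝ}
    (hx₀ : fourierAt x₀ g ≠ 0) :
    ∃ δ : ℝ, 0 < δ ∧ ∀ k : Lp ℂ 1 (volume : Measure ℝ),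
      (∀ x, δ ≤ dist x x₀ → fourierAt x k = 0) → k ∈ I := by
  obtain ⟨V, hV, hV1, -⟩ := exists_fourier_cutoff
  obtain ⟨δ, hδ, hK, hw⟩ := exists_norm_smul_sub_l1Conv_modDilate_lt g x₀ hV (norm_pos_iff.2 hx₀)
  refine ⟨δ, hδ, fun k hk => ?_⟩
  set w := fourierAt x₀ g • hK.toLp - l1Conv g hK.toLp with hw'
  have key : fourierAt x₀ g • k = l1Conv k g + l1Conv w k := by
    apply L1_ext_fourierAt
    intro x
    by_cases hx : δ ≤ dist x x₀
    · simp [fourierAt_l1Conv, hk x hx]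
    · have h1 : fourierAt x hK.toLp = 1 := by
        rw [fourierAt_toL1, fourier_modDilate x₀ hδ, hV1]
        rw [abs_div, abs_of_pos hδ, div_le_one hδ, ← Real.dist_eq]
        exact (not_le.1 hx).le
      rw [hw', map_add, fourierAt_l1Conv, fourierAt_l1Conv, map_sub, map_smul, map_smul,
        fourierAt_l1Conv, h1]
      simp only [smul_eq_mul]
      ring
  have hcl := hI.isClosed
  have h2 : ‖fourierAt x₀ g‖ * ‖I.mkQ k‖ ≤ ‖w‖ * ‖I.mkQ k‖ := by
    rw [← norm_smul, ← map_smul, key, map_add, show I.mkQ (l1Conv k g) = 0 from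
      (Submodule.Quotient.mk_eq_zero I).2 (hI.l1Conv_mem k hg), zero_add]
    exact hI.norm_mk_l1Conv_le w k
  have h3 : ‖I.mkQ k‖ = 0 := by
    by_contra hne
    exact absurd (le_of_mul_le_mul_right h2 (lt_of_le_of_ne (norm_nonneg _) (Ne.symm hne)))
      (not_le.2 hw)
  exact (Submodule.Quotient.mk_eq_zero I).1 (norm_eq_zero.1 h3)

lemma exists_smooth_partition_of_unity {R : ℝ} {δ : ℝ → ℝ} (hδ : ∀ x, 0 < δ x) :
    ∃ (t : Finset ℝ) (ρ : ℝ → ℝ → ℝ), (∀ i, ContDiff ℝ ∞ (ρ i)) ∧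
      (∀ i ∈ t, tsupport (ρ i) ⊆ Metric.ball i (δ i)) ∧
      ∀ x ∈ Metric.closedBall (0 : ℝ) R, ∑ i ∈ t, ρ i x = 1 := by
  obtain ⟨t, ht⟩ := (isCompact_closedBall (0 : ℝ) R).elim_finite_subcover
    (fun i : ℝ => Metric.ball i (δ i)) (fun i => Metric.isOpen_ball)
    (fun x _ => Set.mem_iUnion.2 ⟨x, Metric.mem_ball_self (hδ x)⟩)
  obtain ⟨f, hf⟩ := SmoothPartitionOfUnity.exists_isSubordinate (modelWithCornersSelf ℝ ℝ)
    (Metric.isClosed_closedBall (x := (0 : ℝ)) (ε := R))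
    (fun i : t => Metric.ball (i : ℝ) (δ i)) (fun i => Metric.isOpen_ball)
    (by simpa [Set.iUnion_subtype] using ht)
  classical
  refine ⟨t, fun i => if h : i ∈ t then f ⟨i, h⟩ else fun _ => 0, fun i => ?_, fun i hi => ?_,
    fun x hx => ?_⟩
  · by_cases h : i ∈ t
    · simpa [h] using (f ⟨i, h⟩).contMDiff.contDiff
    · simpa [h] using (contDiff_const : ContDiff ℝ ∞ fun _ : ℝ => (0 : ℝ))
  · simpa [hi] using hf ⟨i, hi⟩
  · rw [← f.sum_eq_one hx, finsum_eq_sum_of_fintype, ← Finset.sum_attach]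
    exact Finset.sum_congr (by ext; simp) fun i _ => by simp

/-- By compactness of `[-R, R]`, a partition of unity on the Fourier side splits `k` into finitely
many pieces to which the local result applies. -/
lemma IsClosedTranslationInvariant.mem_of_fourierAt_eq_zero_of_lt
    (hI : IsClosedTranslationInvariant I) {g : Lp ℂ 1 (volume : Measure ℝ)} (hg : g ∈ I)
    (hg0 : ∀ x, fourierAt x g ≠ 0) {R : ℝ} {k : Lp ℂ 1 (volume : Measure ℝ)}
    (hk : ∀ x, R < |x| → fourierAt x k = 0) : k ∈ I := by
  choose δ hδ hmem using fun x₀ => hI.exists_forall_mem_of_fourierAt_ne_zero hg (hg0 x₀)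
  obtain ⟨t, ρ, hρ, hsub, hsum⟩ := exists_smooth_partition_of_unity (R := R) hδ
  have hcpt : ∀ i ∈ t, HasCompactSupport (ρ i) := fun i hi =>
    HasCompactSupport.of_support_subset_isCompact (isCompact_closedBall i (δ i))
      ((subset_tsupport _).trans ((hsub i hi).trans Metric.ball_subset_closedBall))
  choose! κ hκ using fun i (hi : i ∈ t) => exists_fourierAt_eq (hcpt i hi) (hρ i)
  have h1 : k = ∑ i ∈ t, l1Conv (κ i) k := by
    apply L1_ext_fourierAt
    intro x
    simp only [map_sum, fourierAt_l1Conv, ← Finset.sum_mul]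
    by_cases hx : R < |x|
    · rw [hk x hx, mul_zero]
    · rw [Finset.sum_congr rfl fun i hi => hκ i hi x, ← Complex.ofReal_sum,
        hsum x (by simpa using hx), Complex.ofReal_one, one_mul]
  rw [h1]
  refine I.sum_mem fun i hi => hmem i _ fun x hx => ?_
  rw [fourierAt_l1Conv, hκ i hi, image_eq_zero_of_notMem_tsupport (f := ρ i) ?_, Complex.ofReal_zero, zero_mul]
  exact fun hx' => absurd (Metric.mem_ball.1 (hsub i hi hx')) (not_lt.2 hx)

/-- Wiener's Tauberian theorem for closed translation-invariant subspaces of `L¹(ℝ)`. -/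
theorem IsClosedTranslationInvariant.eq_top_of_fourierAt_ne_zero
    (hI : IsClosedTranslationInvariant I) {g : Lp ℂ 1 (volume : Measure ℝ)} (hg : g ∈ I)
    (hg0 : ∀ x, fourierAt x g ≠ 0) : I = ⊤ := by
  rw [eq_top_iff]
  intro h _
  obtain ⟨V, hV, hV1, hV0⟩ := exists_fourier_cutoff
  -- Functions with compactly supported transform are dense: smooth `h` by a kernel whose transform
  -- vanishes for `|x| ≥ 2R`.
  refine hI.isClosed.closure_subset (Metric.mem_closure_iff.2 fun ε hε => ?_)
  obtain ⟨R, hR, hK, hlt⟩ := exists_norm_sub_l1Conv_modDilate_lt h hV (hV1 0 (by simp)) hε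
  refine ⟨_, hI.mem_of_fourierAt_eq_zero_of_lt hg hg0 (R := 2 * R) fun x hx => ?_,
    by rwa [dist_eq_norm]⟩
  rw [fourierAt_l1Conv, fourierAt_toL1, fourier_modDilate 0 hR, hV0, zero_mul]
  rw [sub_zero, abs_div, abs_of_pos hR, le_div_iff₀ hR]
  exact hx.le

lemma lpTranslate_mem_translateSpan (p : ENNReal) [Fact (1 ≤ p)] (g : ℝ → ℝ) (a : ℝ)
    {h : Lp ℂ p (volume : Measure ℝ)} (hh : h ∈ translateSpan ℂ p g) :
    lpTranslate p a h ∈ translateSpan ℂ p g := by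
  have : translateSpan ℂ p g ≤ (translateSpan ℂ p g).comap (lpTranslate p a).toLinearMap := by
    refine Submodule.span_le.2 ?_
    rintro h ⟨b, hb⟩
    refine Submodule.subset_span ⟨a + b, ?_⟩
    change lpTranslate p a h =ᵐ[volume] _
    filter_upwards [coeFn_lpTranslate p a h,
      (measurePreserving_add_right volume a).quasiMeasurePreserving.ae hb] with x h1 h2
    rw [h1, h2, add_assoc]
  exact this hh

lemma toLp_ofReal_mem_translateSpan {p : ENNReal} [Fact (1 ≤ p)] {g : ℝ → ℝ}
    (hg : MemLp (fun t => (g t : ℂ)) p volume) : hg.toLp ∈ translateSpan ℂ p g := by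
  refine Submodule.subset_span ⟨0, ?_⟩
  simpa using hg.coeFn_toLp

lemma isClosedTranslationInvariant_topologicalClosure_translateSpan (g : ℝ → ℝ) :
    IsClosedTranslationInvariant (translateSpan ℂ 1 g).topologicalClosure where
  isClosed := Submodule.isClosed_topologicalClosure _
  translate_mem a h hh := by
    have : Set.MapsTo (lpTranslate 1 a) (translateSpan ℂ 1 g : Set (Lp ℂ 1 volume))
        (translateSpan ℂ 1 g) := fun h hh => lpTranslate_mem_translateSpan 1 g a hh
    exact this.closure (lpTranslate 1 a).continuous hh

/-- Wiener's Tauberian theorem in `L¹(ℝ)`. -/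
theorem dense_translateSpan_one_iff {g : ℝ → ℝ} (hg : Integrable g) :
    Dense (translateSpan ℂ 1 g : Set (Lp ℂ 1 (volume : Measure ℝ))) ↔
      ∀ x, 𝓕 (fun t => (g t : ℂ)) x ≠ 0 := by
  have hg' : MemLp (fun t => (g t : ℂ)) 1 volume := memLp_one_iff_integrable.2 hg.ofReal
  constructor
  · intro hd x hx
    -- A zero of `ĝ` at `x` confines all translates to the kernel of a continuous functional, which
    -- is nonzero as the bump below shows.
    have h1 : translateSpan ℂ 1 g ≤ (fourierAt x).ker := by
      refine Submodule.span_le.2 ?_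
      rintro h ⟨a, ha⟩
      change fourierAt x h = 0
      rw [fourierAt_apply, Real.fourier_congr_ae ha]
      exact (fourier_comp_add (fun t => (g t : ℂ)) a x).trans (by rw [hx, mul_zero])
    have h2 : ⇑(fourierAt x) = fun _ => 0 :=
      (fourierAt x).continuous.ext_on hd continuous_const fun h hh => h1 hh
    let ρ : ContDiffBump x := ⟨1, 2, one_pos, one_lt_two⟩
    obtain ⟨k, hk⟩ := exists_fourierAt_eq ρ.hasCompactSupport ρ.contDiff
    have h3 := hk x
    rw [h2, ρ.one_of_mem_closedBall (Metric.mem_closedBall_self zero_le_one)] at h3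
    norm_num at h3
  · intro hx
    rw [Submodule.dense_iff_topologicalClosure_eq_top]
    refine (isClosedTranslationInvariant_topologicalClosure_translateSpan g).eq_top_of_fourierAt_ne_zero
      (g := hg'.toLp) (Submodule.le_topologicalClosure _ (toLp_ofReal_mem_translateSpan hg'))
      fun x => ?_
    rw [fourierAt_toL1]
    exact hx x

/-! ### Wiener's theorem in `L²`. -/

/-- The Plancherel transform and the Fourier integral define the same tempered distribution. -/
lemma coeFn_fourier_L2 {u : ℝ → ℂ} (h1 : Integrable u) (h2 : MemLp u 2 volume) :
    (𝓕 (h2.toLp : Lp ℂ 2 (volume : Measure ℝ)) : Lp ℂ 2 (volume : Measure ℝ)) =ᵐ[volume] 𝓕 u := by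
  set v : Lp ℂ 2 (volume : Measure ℝ) := 𝓕 (h2.toLp : Lp ℂ 2 (volume : Measure ℝ)) with hv
  have hc : Continuous (𝓕 u) :=
    VectorFourier.fourierIntegral_continuous Real.continuous_fourierChar
      (innerSL ℝ).continuous₂ h1
  have hvl : LocallyIntegrable v := (Lp.memLp v).locallyIntegrable (by norm_num)
  have key : (fun x => v x - 𝓕 u x) =ᵐ[volume] 0 := by
    refine ae_eq_zero_of_forall_schwartz (hvl.sub hc.locallyIntegrable) fun φ => ?_
    have e1 : ∫ x, φ x * v x = ∫ x, u x * 𝓕 φ x := by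
      have := congrArg (fun T : TemperedDistribution ℝ ℂ => T φ)
        (Lp.fourier_toTemperedDistribution_eq (h2.toLp : Lp ℂ 2 (volume : Measure ℝ)))
      simp only [TemperedDistribution.fourier_apply, Lp.toTemperedDistribution_apply,
        smul_eq_mul] at this
      rw [← hv] at this
      rw [← this]
      apply integral_congr_ae
      filter_upwards [h2.coeFn_toLp] with x hx
      rw [hx, mul_comm]
    have e2 := integral_fourier_mul_eq_flip h1 φ.integrable
    rw [← SchwartzMap.fourier_coe] at e2
    have i1 : Integrable fun x => φ x * v x :=
      MemLp.integrable_mul (φ.memLp 2) (Lp.memLp v)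
    have i2 : Integrable fun x => 𝓕 u x * φ x := by
      refine φ.integrable.bdd_mul (c := ∫ x, ‖u x‖) hc.aestronglyMeasurable
        (.of_forall fun x => ?_)
      exact VectorFourier.norm_fourierIntegral_le_integral_norm _ _ _ _ _
    have : ∀ x, (v x - 𝓕 u x) * φ x = φ x * v x - 𝓕 u x * φ x := fun x => by ring
    simp_rw [this]
    rw [integral_sub i1 i2, e1, e2, sub_self]
  filter_upwards [key] with x hx
  exact sub_eq_zero.1 hx

/-- By Plancherel, with translation by `a` becoming a character. Orthogonality to all translates
thus says that one Fourier transform vanishes identically. -/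
lemma inner_eq_fourier_conj_mul {g : ℝ → ℝ} (hg : Integrable g) (a : ℝ)
    {u : Lp ℂ 2 (volume : Measure ℝ)} (hu : u =ᵐ[volume] fun x => ((g (x + a) : ℝ) : ℂ))
    (h : Lp ℂ 2 (volume : Measure ℝ)) :
    inner ℂ u h = 𝓕 (fun x => (starRingEnd ℂ) (𝓕 (fun t => (g t : ℂ)) x) *
      (𝓕 h : Lp ℂ 2 (volume : Measure ℝ)) x) a := by
  have hm : MemLp (fun x => ((g (x + a) : ℝ) : ℂ)) 2 volume := (memLp_congr_ae hu).1 (Lp.memLp u)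
  have hu' : u = hm.toLp := Lp.ext (hu.trans hm.coeFn_toLp.symm)
  have h1 : Integrable fun x => ((g (x + a) : ℝ) : ℂ) := (hg.comp_add_right a).ofReal
  rw [← Lp.inner_fourier_eq, hu', L2.inner_def, Real.fourier_real_eq]
  apply integral_congr_ae
  filter_upwards [coeFn_fourier_L2 h1 hm] with x hx
  rw [hx, fourier_comp_add (fun t => (g t : ℂ)) a x]
  have : -(x * a) = -(a * x) := by ring
  simp only [RCLike.inner_apply, map_mul, Circle.smul_def, smul_eq_mul, this,
    AddChar.map_neg_eq_inv, Circle.coe_inv_eq_conj]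
  ring

/-- Wiener's closure theorem in `L²(ℝ)`. -/
theorem dense_translateSpan_two_iff {g : ℝ → ℝ} (hg : Integrable g) (hg2 : MemLp g 2 volume) :
    Dense (translateSpan ℂ 2 g : Set (Lp ℂ 2 (volume : Measure ℝ))) ↔
      volume {x | 𝓕 (fun t => (g t : ℂ)) x = 0} = 0 := by
  have hg2' : MemLp (fun t => (g t : ℂ)) 2 volume := hg2.ofReal
  have hc : Continuous (𝓕 (fun t => (g t : ℂ))) :=
    VectorFourier.fourierIntegral_continuous Real.continuous_fourierChar
      (innerSL ℝ).continuous₂ hg.ofReal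
  rw [Submodule.dense_iff_topologicalClosure_eq_top, Submodule.topologicalClosure_eq_top_iff]
  constructor
  · intro hperp
    by_contra hne
    obtain ⟨s, hsm, hs, hs0, hsfin⟩ : ∃ s, MeasurableSet s ∧
        s ⊆ {x | 𝓕 (fun t => (g t : ℂ)) x = 0} ∧ 0 < volume s ∧ volume s < ⊤ :=
      Measure.exists_subset_measure_lt_top (hc.measurable (measurableSet_singleton 0))
        (pos_iff_ne_zero.2 hne)
    let v : Lp ℂ 2 (volume : Measure ℝ) := indicatorConstLp 2 hsm hsfin.ne 1
    have hv0 : v ≠ 0 := by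
      intro h0
      have := norm_indicatorConstLp (p := 2) (hs := hsm) (hμs := hsfin.ne) (c := (1 : ℂ))
        (by norm_num) (by norm_num)
      rw [show indicatorConstLp 2 hsm hsfin.ne (1 : ℂ) = 0 from h0] at this
      have h2 : 0 < volume.real s := ENNReal.toReal_pos hs0.ne' hsfin.ne
      have h3 : 0 < volume.real s ^ (1 / (2 : ENNReal).toReal) := Real.rpow_pos_of_pos h2 _
      simp at this
      simp [← this] at h3
    have hmem : (𝓕⁻ v : Lp ℂ 2 (volume : Measure ℝ)) ∈ (translateSpan ℂ 2 g)ᗮ := by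
      refine (Submodule.isOrtho_span (t := {𝓕⁻ v})).2 ?_ |>.symm
        (Submodule.mem_span_singleton_self _)
      rintro u ⟨a, ha⟩ w rfl
      rw [inner_eq_fourier_conj_mul hg a ha, FourierTransform.fourier_fourierInv_eq v,
        Real.fourier_real_eq]
      apply integral_eq_zero_of_ae
      filter_upwards [indicatorConstLp_coeFn (p := 2) (hs := hsm) (hμs := hsfin.ne)
        (c := (1 : ℂ))] with x hx
      rw [show v x = _ from hx]
      by_cases hxs : x ∈ s
      · rw [show 𝓕 (fun t => (g t : ℂ)) x = 0 from hs hxs]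
        simp
      · simp [hxs]
    rw [hperp, Submodule.mem_bot] at hmem
    apply hv0
    rw [← FourierTransform.fourier_fourierInv_eq (F := Lp ℂ 2 (volume : Measure ℝ)) v, hmem]
    exact (Lp.fourierTransformₗᵢ ℝ ℂ).map_zero
  · intro h0
    rw [Submodule.eq_bot_iff]
    intro h hh
    -- As a product of two `L²` functions, this is within reach of `L¹` uniqueness.
    have hi : Integrable fun x => (starRingEnd ℂ) (𝓕 (fun t => (g t : ℂ)) x) *
        (𝓕 h : Lp ℂ 2 (volume : Measure ℝ)) x := by
      have hm := (memLp_congr_ae (coeFn_fourier_L2 hg.ofReal hg2')).1 (Lp.memLp _)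
      exact MemLp.integrable_mul hm.star (Lp.memLp _)
    have h1 := ae_eq_zero_of_fourier_eq_zero hi fun a => by
      have hm : MemLp (fun x => ((g (x + a) : ℝ) : ℂ)) 2 volume :=
        hg2'.comp_measurePreserving (measurePreserving_add_right volume a)
      rw [← inner_eq_fourier_conj_mul hg a hm.coeFn_toLp]
      exact hh _ (Submodule.subset_span ⟨a, hm.coeFn_toLp⟩)
    have h2 : (𝓕 h : Lp ℂ 2 (volume : Measure ℝ)) = 0 := by
      rw [Lp.eq_zero_iff_ae_eq_zero]
      have h3 : ∀ᵐ x, 𝓕 (fun t => (g t : ℂ)) x ≠ 0 := by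
        rw [ae_iff]; simpa using h0
      filter_upwards [h1, h3] with x hx hx'
      simpa [hx'] using hx
    exact (Lp.fourierTransformₗᵢ ℝ ℂ).injective
      (h2.trans (Lp.fourierTransformₗᵢ ℝ ℂ).map_zero.symm)

/-! ### Independence of the scalar field. -/

section ScalarChange

variable {𝕜 : Type*} [RCLike 𝕜] {p : ENNReal} [Fact (1 ≤ p)] {g : ℝ → ℝ}

/-- The factor `c` makes the span induction close under scalars, since taking real parts is only
`ℝ`-linear. -/
lemma re_smul_mem_translateSpan {u : Lp 𝕜 p (volume : Measure ℝ)} (hu : u ∈ translateSpan 𝕜 p g) :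
    ∀ c : 𝕜, (RCLike.reCLM (K := 𝕜)).compLpL p volume (c • u) ∈ translateSpan ℝ p g := by
  induction hu using Submodule.span_induction with
  | zero => intro c; rw [smul_zero, map_zero]; exact Submodule.zero_mem _
  | add u v _ _ hu hv =>
    intro c
    rw [smul_add, map_add]
    exact Submodule.add_mem _ (hu c) (hv c)
  | smul d u _ hu => intro c; rw [smul_smul]; exact hu _
  | mem u hu =>
    intro c
    obtain ⟨a, ha⟩ := hu
    have h1 : (RCLike.reCLM (K := 𝕜)).compLpL p volume u ∈ translateSpan ℝ p g := by
      refine Submodule.subset_span ⟨a, ?_⟩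
      filter_upwards [(RCLike.reCLM (K := 𝕜)).coeFn_compLpL u, ha] with x h1 h2
      rw [h1, h2]
      simp
    have h2 : (RCLike.reCLM (K := 𝕜)).compLpL p volume (c • u) =
        RCLike.re c • (RCLike.reCLM (K := 𝕜)).compLpL p volume u := by
      apply Lp.ext
      filter_upwards [(RCLike.reCLM (K := 𝕜)).coeFn_compLpL u,
        (RCLike.reCLM (K := 𝕜)).coeFn_compLpL (c • u), Lp.coeFn_smul c u,
        Lp.coeFn_smul (RCLike.re c) ((RCLike.reCLM (K := 𝕜)).compLpL p volume u), ha]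
        with x h1 h2 h3 h4 h5
      rw [h2, h3, h4, Pi.smul_apply, Pi.smul_apply, h1, h5]
      simp
    rw [h2]
    exact Submodule.smul_mem _ _ h1

lemma ofReal_mem_translateSpan {u : Lp ℝ p (volume : Measure ℝ)} (hu : u ∈ translateSpan ℝ p g) :
    (RCLike.ofRealCLM (K := 𝕜)).compLpL p volume u ∈ translateSpan 𝕜 p g := by
  induction hu using Submodule.span_induction with
  | zero => rw [map_zero]; exact Submodule.zero_mem _
  | add u v _ _ hu hv => rw [map_add]; exact Submodule.add_mem _ hu hv
  | smul d u _ hu =>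
    rw [map_smul, ← algebraMap_smul 𝕜 d]
    exact Submodule.smul_mem _ _ hu
  | mem u hu =>
    obtain ⟨a, ha⟩ := hu
    refine Submodule.subset_span ⟨a, ?_⟩
    filter_upwards [(RCLike.ofRealCLM (K := 𝕜)).coeFn_compLpL u, ha] with x h1 h2
    rw [h1, h2]
    simp

variable (𝕜 p g) in
lemma dense_translateSpan_iff_real :
    Dense (translateSpan 𝕜 p g : Set (Lp 𝕜 p (volume : Measure ℝ))) ↔
      Dense (translateSpan ℝ p g : Set (Lp ℝ p (volume : Measure ℝ))) := by
  set R := (RCLike.reCLM (K := 𝕜)).compLpL p (volume : Measure ℝ) with hR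
  set J := (RCLike.imCLM (K := 𝕜)).compLpL p (volume : Measure ℝ) with hJ
  set O := (RCLike.ofRealCLM (K := 𝕜)).compLpL p (volume : Measure ℝ) with hO
  constructor
  · intro hd h
    have h1 : R (O h) = h := by
      apply Lp.ext
      filter_upwards [(RCLike.reCLM (K := 𝕜)).coeFn_compLpL (O h),
        (RCLike.ofRealCLM (K := 𝕜)).coeFn_compLpL h] with x h1 h2
      rw [h1, h2]
      simp
    have h2 : Set.MapsTo R (translateSpan 𝕜 p g : Set (Lp 𝕜 p (volume : Measure ℝ)))
        (translateSpan ℝ p g) := fun u hu => by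
      simpa using re_smul_mem_translateSpan hu 1
    rw [← h1]
    exact h2.closure R.continuous (hd (O h))
  · intro hd h
    have h1 : ∀ u, O u ∈ (translateSpan 𝕜 p g).topologicalClosure := fun u => by
      have h2 : Set.MapsTo O (translateSpan ℝ p g : Set (Lp ℝ p (volume : Measure ℝ)))
        (translateSpan 𝕜 p g) := fun u hu => ofReal_mem_translateSpan hu
      exact h2.closure O.continuous (hd u)
    have h3 : h = O (R h) + (RCLike.I : 𝕜) • O (J h) := by
      apply Lp.ext
      filter_upwards [(RCLike.reCLM (K := 𝕜)).coeFn_compLpL h,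
        (RCLike.imCLM (K := 𝕜)).coeFn_compLpL h,
        (RCLike.ofRealCLM (K := 𝕜)).coeFn_compLpL (R h),
        (RCLike.ofRealCLM (K := 𝕜)).coeFn_compLpL (J h),
        Lp.coeFn_add (O (R h)) ((RCLike.I : 𝕜) • O (J h)),
        Lp.coeFn_smul (RCLike.I : 𝕜) (O (J h))] with x h1 h2 h3 h4 h5 h6
      rw [h5, Pi.add_apply, h6, Pi.smul_apply, h3, h4, h1, h2]
      simp only [RCLike.ofRealCLM_apply, RCLike.reCLM_apply, RCLike.imCLM_apply, smul_eq_mul]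
      rw [mul_comm, RCLike.re_add_im]
    rw [h3]
    exact Submodule.add_mem _ (h1 _) (Submodule.smul_mem _ _ (h1 _))

variable (𝕜 p g) in
lemma dense_translateSpan_iff_complex :
    Dense (translateSpan 𝕜 p g : Set (Lp 𝕜 p (volume : Measure ℝ))) ↔
      Dense (translateSpan ℂ p g : Set (Lp ℂ p (volume : Measure ℝ))) :=
  (dense_translateSpan_iff_real 𝕜 p g).trans (dense_translateSpan_iff_real ℂ p g).symm

end ScalarChange

/-! ### Hyperplane slices and Heine's formula. -/

/-- For fixed `s` the last coordinate is a translate of `t`, so the map is a shear followed by a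
relabelling of coordinates. -/
lemma measurePreserving_hyperplanePoint (m : ℕ) :
    MeasurePreserving (fun q : ℝ × (Fin m → ℝ) => hyperplanePoint q.1 q.2)
      (volume.prod volume) volume := by
  have h1 : MeasurePreserving (fun q : (Fin m → ℝ) × ℝ => (q.1, q.2 - ∑ i, q.1 i))
      (volume.prod volume) (volume.prod volume) :=
    (MeasurePreserving.id volume).skew_product
      (g := fun (s : Fin m → ℝ) (t : ℝ) => t - ∑ i, s i) (by fun_prop)
      (.of_forall fun s => (measurePreserving_sub_right volume (∑ i, s i)).map_eq)
  have h2 := (volume_preserving_piFinSuccAbove (fun _ : Fin (m + 1) => ℝ) (Fin.last m)).symm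
  have h3 := h2.comp (Measure.measurePreserving_swap.comp
    (h1.comp (Measure.measurePreserving_swap (μ := (volume : Measure ℝ))
      (ν := (volume : Measure (Fin m → ℝ))))))
  have h4 : (fun q : ℝ × (Fin m → ℝ) => hyperplanePoint q.1 q.2) =
      (MeasurableEquiv.piFinSuccAbove (fun _ : Fin (m + 1) => ℝ) (Fin.last m)).symm ∘
        Prod.swap ∘ (fun q : (Fin m → ℝ) × ℝ => (q.1, q.2 - ∑ i, q.1 i)) ∘ Prod.swap := by
    funext q
    simp [hyperplanePoint, Fin.snocEquiv]
  rw [h4]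
  exact h3

lemma sum_hyperplanePoint {m : ℕ} (t : ℝ) (s : Fin m → ℝ) :
    ∑ i, hyperplanePoint t s i = t := by
  simp [hyperplanePoint, Fin.sum_univ_castSucc]

section Heine

variable {n : ℕ} {w : ℝ → ℂ}

/-- Leibniz expansion of both factors of the squared Vandermonde determinant separates the
variables. -/
lemma prod_sub_sq_mul_prod_eq_sum (n : ℕ) (w : ℝ → ℂ) (p : Fin n → ℝ) :
    ((∏ i, ∏ j ∈ Finset.Ioi i, (p i - p j) ^ 2 : ℝ) : ℂ) * ∏ i, w (p i) =
      ∑ τ : Equiv.Perm (Fin n), ∑ σ : Equiv.Perm (Fin n),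
        ((Equiv.Perm.sign τ : ℤ) : ℂ) * ((Equiv.Perm.sign σ : ℤ) : ℂ) *
          ∏ i, ((p i : ℂ) ^ ((σ i : ℕ) + (τ i : ℕ)) * w (p i)) := by
  have h1 : ((∏ i, ∏ j ∈ Finset.Ioi i, (p i - p j) ^ 2 : ℝ) : ℂ) =
      (Matrix.vandermonde fun i => (p i : ℂ)).det * (Matrix.vandermonde fun i => (p i : ℂ)).det := by
    rw [Matrix.det_vandermonde, ← Finset.prod_mul_distrib]
    push_cast
    refine Finset.prod_congr rfl fun i _ => ?_
    rw [← Finset.prod_mul_distrib]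
    exact Finset.prod_congr rfl fun j _ => by ring
  have h2 : (Matrix.vandermonde fun i => (p i : ℂ)).det =
      ∑ σ : Equiv.Perm (Fin n), ((Equiv.Perm.sign σ : ℤ) : ℂ) * ∏ i, (p i : ℂ) ^ (σ i : ℕ) := by
    rw [← Matrix.det_transpose, Matrix.det_apply']
    rfl
  rw [h1, h2, Finset.sum_mul_sum, Finset.sum_mul]
  refine Finset.sum_congr rfl fun τ _ => ?_
  rw [Finset.sum_mul]
  refine Finset.sum_congr rfl fun σ _ => ?_
  rw [Finset.prod_mul_distrib]
  simp_rw [pow_add]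
  rw [Finset.prod_mul_distrib]
  ring

lemma integrable_prod_pow_mul (hw : ∀ k ≤ 2 * n - 2, Integrable fun t : ℝ => (t : ℂ) ^ k * w t)
    (σ τ : Equiv.Perm (Fin n)) :
    Integrable fun p : Fin n → ℝ => ∏ i, ((p i : ℂ) ^ ((σ i : ℕ) + (τ i : ℕ)) * w (p i)) :=
  Integrable.fintype_prod (f := fun i t => ((t : ℝ) : ℂ) ^ ((σ i : ℕ) + (τ i : ℕ)) * w t)
    fun i => hw _ (by omega)

lemma integrable_prod_sub_sq_mul_prod
    (hw : ∀ k ≤ 2 * n - 2, Integrable fun t : ℝ => (t : ℂ) ^ k * w t) :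
    Integrable fun p : Fin n → ℝ =>
      ((∏ i, ∏ j ∈ Finset.Ioi i, (p i - p j) ^ 2 : ℝ) : ℂ) * ∏ i, w (p i) := by
  simp_rw [prod_sub_sq_mul_prod_eq_sum]
  exact integrable_finsetSum _ fun τ _ => integrable_finsetSum _ fun σ _ =>
    (integrable_prod_pow_mul hw σ τ).const_mul _

/-- Heine's formula for a Hankel determinant of moments. -/
lemma integral_prod_sub_sq_mul_prod
    (hw : ∀ k ≤ 2 * n - 2, Integrable fun t : ℝ => (t : ℂ) ^ k * w t) :
    ∫ p : Fin n → ℝ, ((∏ i, ∏ j ∈ Finset.Ioi i, (p i - p j) ^ 2 : ℝ) : ℂ) * ∏ i, w (p i) =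
      n.factorial * Matrix.det (Matrix.of fun i j : Fin n =>
        ∫ t : ℝ, (t : ℂ) ^ ((i : ℕ) + (j : ℕ)) * w t) := by
  set M : Matrix (Fin n) (Fin n) ℂ := Matrix.of fun i j : Fin n =>
        ∫ t : ℝ, (t : ℂ) ^ ((i : ℕ) + (j : ℕ)) * w t with hM
  simp_rw [prod_sub_sq_mul_prod_eq_sum]
  rw [integral_finsetSum _ fun τ _ => integrable_finsetSum _ fun σ _ =>
    (integrable_prod_pow_mul hw σ τ).const_mul _]
  -- For fixed `τ` the sum over `σ` is the determinant of `M` with columns permuted by `τ`; its sign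
  -- cancels that of `τ`, leaving `n!` equal terms.
  have h1 : ∀ τ : Equiv.Perm (Fin n), ∫ p : Fin n → ℝ, ∑ σ : Equiv.Perm (Fin n),
        ((Equiv.Perm.sign τ : ℤ) : ℂ) * ((Equiv.Perm.sign σ : ℤ) : ℂ) *
          ∏ i, ((p i : ℂ) ^ ((σ i : ℕ) + (τ i : ℕ)) * w (p i)) = M.det := by
    intro τ
    rw [integral_finsetSum _ fun σ _ => (integrable_prod_pow_mul hw σ τ).const_mul _]
    have h2 : ∀ σ : Equiv.Perm (Fin n), ∫ p : Fin n → ℝ,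
        ((Equiv.Perm.sign τ : ℤ) : ℂ) * ((Equiv.Perm.sign σ : ℤ) : ℂ) *
          ∏ i, ((p i : ℂ) ^ ((σ i : ℕ) + (τ i : ℕ)) * w (p i)) =
        ((Equiv.Perm.sign τ : ℤ) : ℂ) * (((Equiv.Perm.sign σ : ℤ) : ℂ) *
          ∏ i, M.submatrix id τ (σ i) i) := by
      intro σ
      rw [integral_const_mul, integral_fintype_prod_volume_eq_prod
        (f := fun i t => ((t : ℝ) : ℂ) ^ ((σ i : ℕ) + (τ i : ℕ)) * w t), mul_assoc]
      rfl
    simp_rw [h2]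
    rw [← Finset.mul_sum, ← Matrix.det_apply', Matrix.det_permute', ← mul_assoc, ← Int.cast_mul,
      ← Units.val_mul, Int.units_mul_self]
    simp
  simp_rw [h1]
  simp [Fintype.card_perm]

end Heine

/-! ### The Wronskian and the transform of the correlation function. -/

lemma integrable_pow_mul_of_le {f : ℝ → ℝ} {N : ℕ} (hf : Integrable f)
    (hN : Integrable fun t : ℝ => t ^ N * f t) {k : ℕ} (hk : k ≤ N) :
    Integrable fun t : ℝ => t ^ k * f t := by
  refine (hf.norm.add hN.norm).mono'
    ((by fun_prop : Continuous fun t : ℝ => t ^ k).aestronglyMeasurable.mul hf.1)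
    (.of_forall fun t => ?_)
  simp only [Pi.add_apply, norm_mul, norm_pow]
  have h : ‖t‖ ^ k ≤ 1 + ‖t‖ ^ N := by
    rcases le_total ‖t‖ 1 with h | h
    · exact (pow_le_one₀ (norm_nonneg _) h).trans (le_add_of_nonneg_right (by positivity))
    · exact (pow_le_pow_right₀ h hk).trans (le_add_of_nonneg_left zero_le_one)
  calc ‖t‖ ^ k * ‖f t‖ ≤ (1 + ‖t‖ ^ N) * ‖f t‖ := by gcongr
    _ = _ := by ring

lemma fourierTransform_eq (f : ℝ → ℝ) :
    fourierTransform f = fun x => 𝓕 (fun t => (f t : ℂ)) ((2 * Real.pi)⁻¹ * x) := by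
  ext x
  rw [fourierTransform, Real.fourier_real_eq_integral_exp_smul]
  congr with t
  rw [smul_eq_mul]
  congr 2
  push_cast
  field_simp

section Wronskian

variable {n : ℕ} {f : ℝ → ℝ}

lemma integrable_pow_mul_ofReal
    (hf : ∀ k ≤ 2 * n - 2, Integrable fun t : ℝ => t ^ k * f t) :
    ∀ k ≤ 2 * n - 2, Integrable fun t : ℝ => (t : ℂ) ^ k * (f t : ℂ) := fun k hk => by
  simpa using (hf k hk).ofReal (𝕜 := ℂ)

lemma integrable_pow_mul_fourierChar
    (hf : ∀ k ≤ 2 * n - 2, Integrable fun t : ℝ => t ^ k * f t) (x : ℝ) :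
    ∀ k ≤ 2 * n - 2,
      Integrable fun t : ℝ => (t : ℂ) ^ k * (((𝐞 (-(t * x)) : Circle) : ℂ) * (f t : ℂ)) :=
  fun k hk => by
  have h : Integrable fun t : ℝ => ((𝐞 (-(t * x)) : Circle) : ℂ) * ((t : ℂ) ^ k * (f t : ℂ)) := by
    refine (integrable_pow_mul_ofReal hf k hk).bdd_mul (c := 1) ?_
      (.of_forall fun y => (Circle.norm_coe _).le)
    exact (by fun_prop : Continuous fun t : ℝ =>
      ((𝐞 (-(t * x)) : Circle) : ℂ)).aestronglyMeasurable
  refine h.congr (.of_forall fun t => ?_)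
  ring

lemma integrable_correlation_integrand {m : ℕ}
    (hf : ∀ k ≤ 2 * (m + 1) - 2, Integrable fun t : ℝ => t ^ k * f t) :
    Integrable (fun q : ℝ × (Fin m → ℝ) =>
      (∏ i, ∏ j ∈ Finset.Ioi i, (hyperplanePoint q.1 q.2 i - hyperplanePoint q.1 q.2 j) ^ 2) *
        ∏ i, f (hyperplanePoint q.1 q.2 i)) (volume.prod volume) := by
  have h1 := integrable_prod_sub_sq_mul_prod (integrable_pow_mul_ofReal hf)
  have h2 : Integrable fun p : Fin (m + 1) → ℝ =>
      (∏ i, ∏ j ∈ Finset.Ioi i, (p i - p j) ^ 2) * ∏ i, f (p i) := by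
    simpa only [← Complex.ofReal_prod, ← Complex.ofReal_mul, RCLike.re_to_complex,
      Complex.ofReal_re] using h1.re
  exact (measurePreserving_hyperplanePoint m).integrable_comp_of_integrable h2

lemma integrable_correlationFun
    (hf : ∀ k ≤ 2 * n - 2, Integrable fun t : ℝ => t ^ k * f t) :
    Integrable (correlationFun n f) := by
  cases n with
  | zero => exact integrable_zero _ _ _
  | succ m => exact (integrable_correlation_integrand hf).integral_prod_left

/-- The Hankel matrix of the functions `y ↦ ∫ t^k e^{-2πi t y} f(t) dt`. -/
noncomputable def fourierHankel (n : ℕ) (f : ℝ → ℝ) (y : ℝ) : Matrix (Fin n) (Fin n) ℂ :=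
  Matrix.of fun i j =>
    ∫ t : ℝ, (t : ℂ) ^ ((i : ℕ) + (j : ℕ)) * (((𝐞 (-(t * y)) : Circle) : ℂ) * (f t : ℂ))

/-- Heine's formula for the weight `𝐞 (-(t * y)) * f t`, whose characters multiply to a function of
`p_1 + ⋯ + p_n` alone. -/
lemma fourier_correlationFun {m : ℕ}
    (hf : ∀ k ≤ 2 * (m + 1) - 2, Integrable fun t : ℝ => t ^ k * f t) (y : ℝ) :
    𝓕 (fun t => (correlationFun (m + 1) f t : ℂ)) y =
      (m + 1).factorial * (fourierHankel (m + 1) f y).det := by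
  have hint := integrable_prod_sub_sq_mul_prod (integrable_pow_mul_fourierChar hf y)
  have hprod := integral_prod _
    ((measurePreserving_hyperplanePoint m).integrable_comp_of_integrable hint)
  simp only [Function.comp_def] at hprod
  rw [fourierHankel, ← integral_prod_sub_sq_mul_prod (integrable_pow_mul_fourierChar hf y),
    ← (measurePreserving_hyperplanePoint m).map_eq,
    integral_map (measurePreserving_hyperplanePoint m).aemeasurable
      (by rw [(measurePreserving_hyperplanePoint m).map_eq]; exact hint.1),
    hprod, Real.fourier_real_eq]
  congr with t
  rw [correlationFun, ← integral_complex_ofReal, Circle.smul_def, smul_eq_mul,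
    ← integral_const_mul]
  congr with s
  have h1 : ∏ i, ((𝐞 (-(hyperplanePoint t s i * y)) : Circle) : ℂ) =
      ((𝐞 (-(t * y)) : Circle) : ℂ) := by
    have h2 : 𝐞 (-(t * y)) = ∏ i, 𝐞 (-(hyperplanePoint t s i * y)) := by
      rw [show -(t * y) = ∑ i, -(hyperplanePoint t s i * y) by
        rw [Finset.sum_neg_distrib, ← Finset.sum_mul, sum_hyperplanePoint]]
      exact map_prod Real.fourierChar.toMonoidHom
        (fun i => Multiplicative.ofAdd (-(hyperplanePoint t s i * y))) Finset.univ
    rw [h2]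
    exact (map_prod Circle.coeHom (fun i => 𝐞 (-(hyperplanePoint t s i * y))) Finset.univ).symm
  rw [Finset.prod_mul_distrib, h1]
  push_cast
  ring

lemma contDiff_fourier_ofReal
    (hf : ∀ k ≤ 2 * n - 2, Integrable fun t : ℝ => t ^ k * f t) :
    ContDiff ℝ (2 * n - 2 : ℕ) (𝓕 fun t => (f t : ℂ)) := by
  refine Real.contDiff_fourier (N := (2 * n - 2 : ℕ)) fun k hk => ?_
  have := (hf k (by exact_mod_cast hk)).norm
  simpa using this

lemma contDiff_fourierTransform
    (hf : ∀ k ≤ 2 * n - 2, Integrable fun t : ℝ => t ^ k * f t) :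
    ContDiff ℝ (2 * n - 2 : ℕ) (fourierTransform f) := by
  rw [fourierTransform_eq]
  exact (contDiff_fourier_ofReal hf).comp (contDiff_const.mul contDiff_id)

lemma iteratedDeriv_fourierTransform
    (hf : ∀ k ≤ 2 * n - 2, Integrable fun t : ℝ => t ^ k * f t) {k : ℕ} (hk : k ≤ 2 * n - 2)
    (x : ℝ) :
    iteratedDeriv k (fourierTransform f) x = (-Complex.I) ^ k *
      ∫ t : ℝ, (t : ℂ) ^ k * (((𝐞 (-(t * ((2 * Real.pi)⁻¹ * x))) : Circle) : ℂ) * (f t : ℂ)) := by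
  have hscale := congrFun (iteratedDeriv_comp_const_smul (n := k)
    ((contDiff_fourier_ofReal hf).of_le (m := k) (by exact_mod_cast hk)) (2 * Real.pi)⁻¹) x
  rw [fourierTransform_eq, hscale,
    Real.iteratedDeriv_fourier (N := (2 * n - 2 : ℕ)) _ (by exact_mod_cast hk)]
  · simp only [Real.fourier_real_eq]
    rw [← integral_smul, ← integral_const_mul]
    congr with t
    have hpi : (Real.pi : ℂ) ≠ 0 := by exact_mod_cast Real.pi_ne_zero
    simp only [Circle.smul_def, smul_eq_mul, Complex.real_smul]
    push_cast
    -- The factor `(2π)^k` cancels the one coming from the rescaled argument.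
    have : (-2 * Real.pi * Complex.I * t : ℂ) ^ k =
        (2 * Real.pi) ^ k * ((-Complex.I) ^ k * t ^ k) := by
      rw [← mul_pow, ← mul_pow]; congr 1; ring
    rw [this, inv_pow]
    field_simp
  · intro j hj
    have := integrable_pow_mul_ofReal hf j (by exact_mod_cast hj)
    simpa using this

/-- Since `(-i)^{i+j} = (-i)^i (-i)^j`, the powers come out of the rows and the columns separately.
-/
lemma wronskianDet_fourierTransform
    (hf : ∀ k ≤ 2 * n - 2, Integrable fun t : ℝ => t ^ k * f t) (x : ℝ) :
    wronskianDet n (fourierTransform f) x =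
      (∏ i : Fin n, (-Complex.I) ^ (i : ℕ)) * ((∏ i : Fin n, (-Complex.I) ^ (i : ℕ)) *
        (fourierHankel n f ((2 * Real.pi)⁻¹ * x)).det) := by
  rw [wronskianDet, ← Matrix.det_mul_row, ← Matrix.det_mul_column]
  congr 1
  ext i j
  simp only [Matrix.of_apply, fourierHankel]
  rw [iteratedDeriv_fourierTransform hf (by omega), pow_add]
  ring

lemma wronskianDet_fourierTransform_eq_zero_iff (hn : n ≠ 0)
    (hf : ∀ k ≤ 2 * n - 2, Integrable fun t : ℝ => t ^ k * f t) (x : ℝ) :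
    wronskianDet n (fourierTransform f) x = 0 ↔
      𝓕 (fun t => (correlationFun n f t : ℂ)) ((2 * Real.pi)⁻¹ * x) = 0 := by
  obtain ⟨m, rfl⟩ := Nat.exists_eq_succ_of_ne_zero hn
  have h : ∏ i : Fin (m + 1), (-Complex.I) ^ (i : ℕ) ≠ 0 :=
    Finset.prod_ne_zero_iff.2 fun i _ => pow_ne_zero _ (neg_ne_zero.2 Complex.I_ne_zero)
  rw [wronskianDet_fourierTransform hf, fourier_correlationFun hf]
  simp [h, Nat.factorial_ne_zero]

end Wronskian

theorem mainTheorem6 {𝕜 : Type*} [RCLike 𝕜] (n : ℕ) (hn : 2 ≤ n) (f : ℝ → ℝ)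
    (hf_nonneg : 0 ≤ᵐ[volume] f) (hf : Integrable f volume)
    (hf_moment : Integrable (fun t : ℝ => t ^ (2 * n - 2) * f t) volume) :
    ContDiff ℝ (2 * n - 2 : ℕ) (fourierTransform f) ∧
    Integrable (correlationFun n f) volume ∧
    ((∀ x : ℝ, wronskianDet n (fourierTransform f) x ≠ 0) ↔
      Dense (translateSpan 𝕜 1 (correlationFun n f) : Set (Lp 𝕜 1 (volume : Measure ℝ)))) ∧
    (MemLp (correlationFun n f) 2 volume →
      (volume {x : ℝ | wronskianDet n (fourierTransform f) x = 0} = 0 ↔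
        Dense (translateSpan 𝕜 2 (correlationFun n f) :
          Set (Lp 𝕜 2 (volume : Measure ℝ))))) := by
  have hmom : ∀ k ≤ 2 * n - 2, Integrable fun t : ℝ => t ^ k * f t :=
    fun k hk => integrable_pow_mul_of_le hf hf_moment hk
  have hν := integrable_correlationFun hmom
  have hW := wronskianDet_fourierTransform_eq_zero_iff (by omega) hmom
  have hpi : (2 * Real.pi)⁻¹ ≠ 0 := inv_ne_zero (by positivity)
  refine ⟨contDiff_fourierTransform hmom, hν, ?_, fun hν2 => ?_⟩
  · rw [dense_translateSpan_iff_complex, dense_translateSpan_one_iff hν]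
    refine ⟨fun h y => ?_, fun h x => (hW x).not.2 (h _)⟩
    have := (hW (2 * Real.pi * y)).not.1 (h _)
    rwa [inv_mul_cancel_left₀ (by positivity)] at this
  · rw [dense_translateSpan_iff_complex, dense_translateSpan_two_iff hν hν2]
    have : {x : ℝ | wronskianDet n (fourierTransform f) x = 0} =
        (fun x => (2 * Real.pi)⁻¹ * x) ⁻¹'
          {y | 𝓕 (fun t => (correlationFun n f t : ℂ)) y = 0} := Set.ext hW
    -- The two zero sets differ by the dilation between the Fourier normalizations, which preserves
    -- null sets.
    rw [this, Real.volume_preimage_mul_left hpi, mul_eq_zero]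
    simp [Real.pi_pos.ne']
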